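/- **Proposition 4.6.** Let $\mathbb K$ be a field. For a finite simple graph $G$, let $I_G\subseteq \mathbb K[x_e : e\in E(G)]$ be its toric ideal, i.e. the ideal generated by all binomials $x^{a}-x^{b}$ with $\sum_{e} a_e\,\mathbf a_e=\sum_{e} b_e\,\mathbf a_e$, where $\mathbf a_e\in\mathbb N^{V(G)}$ is the characteristic vector of the edge $e$ (value $1$ at its two endpoints and $0$ elsewhere). Call $G$ an *MG-graph* (over $\mathbb K$) if for some monomial order the reduced Gröbner basis of $I_G$ is a minimal generating set of $I_G$ (it generates $I_G$ and none of its proper subsets does), and a *UMG-graph* (over $\mathbb K$) if for every monomial order the reduced Gröbner basis of $I_G$ is a minimal generating set of $I_G$. A *1-clique sum* of two vertex-disjoint graphs is obtained from their disjoint union by identifying a vertex of the first with a vertex of the second; a *2-clique sum* is obtained from their disjoint union by identifying an edge of the first with an edge of the second (in either of the two ways of matching the endpoints). Let $G_1$ and $G_2$ be vertex-disjoint finite simple graphs. If $G_1$ is a UMG-graph, $G_2$ is an MG-graph, and at least one of $G_1,G_2$ is bipartite, then every 1-clique sum and every 2-clique sum of $G_1$ and $G_2$ is an MG-graph. -/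

import Mathlib

universe u v

/-- The `A`-degree of the monomial with exponent `w`, for a family `A` of vectors in `ℕⁿ`
(coordinates indexed by `V`): `deg_A (x ^ w) = ∑ i, w i • A i`. -/
noncomputable def aDegree {V ι : Type*} (A : ι → V → ℕ) (w : ι →₀ ℕ) : V → ℕ :=
  w.sum fun i n => n • A i

/-- The toric ideal `I_A = ⟨x ^ a - x ^ b : deg_A (x ^ a) = deg_A (x ^ b)⟩`. -/
noncomputable def toricIdeal (K : Type*) [Field K] {V ι : Type*} (A : ι → V → ℕ) :
    Ideal (MvPolynomial ι K) :=
  Ideal.span {p | ∃ a b : ι →₀ ℕ, aDegree A a = aDegree A b ∧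
    p = MvPolynomial.monomial a 1 - MvPolynomial.monomial b 1}

/-- The characteristic vector of an edge: `1` at its two endpoints and `0` elsewhere. -/
noncomputable def edgeVector {V : Type*} (G : SimpleGraph V) (e : G.edgeSet) : V → ℕ :=
  Set.indicator {x : V | x ∈ (e : Sym2 V)} 1

/-- The toric ideal `I_G` of a graph, in the polynomial ring over `K` with one variable
for each edge of `G`. -/
noncomputable def SimpleGraph.toricIdeal (K : Type*) [Field K] {V : Type*} (G : SimpleGraph V) :
    Ideal (MvPolynomial G.edgeSet K) :=
  _root_.toricIdeal K (edgeVector G)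

/-- `S` is a Gröbner basis of the ideal `I` for the monomial order `m`: a finite subset of `I`
whose leading terms generate the initial ideal of `I`. -/
structure IsGroebnerBasis {σ K : Type*} [Field K] (m : MonomialOrder σ)
    (I : Ideal (MvPolynomial σ K)) (S : Set (MvPolynomial σ K)) : Prop where
  finite : S.Finite
  subset : S ⊆ (I : Set (MvPolynomial σ K))
  span_leadingTerm : Ideal.span (m.leadingTerm '' S) =
    Ideal.span (m.leadingTerm '' (I : Set (MvPolynomial σ K)))

/-- `S` is the reduced Gröbner basis of `I` for `m`: its elements have leading coefficient `1`
(so they are nonzero), and no monomial of an element of `S` is divisible by the leading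
monomial of another element of `S`. -/
structure IsReducedGroebnerBasis {σ K : Type*} [Field K] (m : MonomialOrder σ)
    (I : Ideal (MvPolynomial σ K)) (S : Set (MvPolynomial σ K)) : Prop
    extends IsGroebnerBasis m I S where
  leadingCoeff_eq_one : ∀ p ∈ S, m.leadingCoeff p = 1
  not_dvd : ∀ p ∈ S, ∀ q ∈ S, q ≠ p → ∀ d ∈ p.support, ¬ m.degree q ≤ d

/-- `S` generates the ideal `I`, and no proper subset of `S` does. -/
def IsMinimalGeneratingSet {R : Type*} [CommRing R] (I : Ideal R) (S : Set R) : Prop :=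
  Ideal.span S = I ∧ ∀ T : Set R, T ⊂ S → Ideal.span T ≠ I

/-- `I` is an MG-ideal: for some monomial order, the reduced Gröbner basis of `I` is a minimal
generating set of `I`. (The carrier `syn` of a monomial order may be taken to be a copy of
`σ →₀ ℕ`, so that the universe chosen for it loses no monomial order.) -/
def IsMGIdeal {σ : Type u} {K : Type v} [Field K] (I : Ideal (MvPolynomial σ K)) : Prop :=
  ∃ (m : MonomialOrder.{u, u} σ) (S : Set (MvPolynomial σ K)),
    IsReducedGroebnerBasis m I S ∧ IsMinimalGeneratingSet I S

/-- `I` is a UMG-ideal: for every monomial order, the reduced Gröbner basis of `I` is a minimal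
generating set of `I`. -/
def IsUMGIdeal {σ : Type u} {K : Type v} [Field K] (I : Ideal (MvPolynomial σ K)) : Prop :=
  ∀ (m : MonomialOrder.{u, u} σ) (S : Set (MvPolynomial σ K)),
    IsReducedGroebnerBasis m I S → IsMinimalGeneratingSet I S

/-- `G` is an MG-graph (over the field `K`). -/
def SimpleGraph.IsMG (K : Type*) [Field K] {V : Type*} (G : SimpleGraph V) : Prop :=
  IsMGIdeal (G.toricIdeal K)

/-- `G` is a UMG-graph (over the field `K`). -/
def SimpleGraph.IsUMG (K : Type*) [Field K] {V : Type*} (G : SimpleGraph V) : Prop :=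
  IsUMGIdeal (G.toricIdeal K)

/-- `H` is obtained from the disjoint union of `G₁` and `G₂` by identifying exactly the pairs
`a : V₁`, `b : V₂` with `r a b` (`f₁` and `f₂` are the maps from the two vertex sets to the
vertex set of `H`; edges with the same image become one edge). -/
def IsGluing {V₁ V₂ W : Type*} (r : V₁ → V₂ → Prop)
    (G₁ : SimpleGraph V₁) (G₂ : SimpleGraph V₂) (H : SimpleGraph W) : Prop :=
  ∃ (f₁ : V₁ ↪ W) (f₂ : V₂ ↪ W),
    Set.range f₁ ∪ Set.range f₂ = Set.univ ∧
    (∀ a b, f₁ a = f₂ b ↔ r a b) ∧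
    H = G₁.map f₁ ⊔ G₂.map f₂

/-- `H` is a 1-clique sum of `G₁` and `G₂`: a vertex `v₁` of `G₁` is identified with a vertex
`v₂` of `G₂`. -/
def IsOneCliqueSum {V₁ V₂ W : Type*}
    (G₁ : SimpleGraph V₁) (G₂ : SimpleGraph V₂) (H : SimpleGraph W) : Prop :=
  ∃ (v₁ : V₁) (v₂ : V₂), IsGluing (fun a b => a = v₁ ∧ b = v₂) G₁ G₂ H

/-- `H` is a 2-clique sum of `G₁` and `G₂`: an edge `{u₁, v₁}` of `G₁` is identified with an
edge `{u₂, v₂}` of `G₂`, where `u₁` becomes `u₂` and `v₁` becomes `v₂`. -/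
def IsTwoCliqueSum {V₁ V₂ W : Type*}
    (G₁ : SimpleGraph V₁) (G₂ : SimpleGraph V₂) (H : SimpleGraph W) : Prop :=
  ∃ (u₁ v₁ : V₁) (u₂ v₂ : V₂), G₁.Adj u₁ v₁ ∧ G₂.Adj u₂ v₂ ∧
    IsGluing (fun a b => (a = u₁ ∧ b = u₂) ∨ (a = v₁ ∧ b = v₂)) G₁ G₂ H

/-! In each fibre (the monomials of one multidegree) a monomial order singles out a smallest
monomial. The initial ideal of a toric ideal consists of the monomials that are not smallest, so a
finite set of monic elements of the ideal is a Gröbner basis as soon as every non-smallest monomial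
is divisible by one of its leading monomials (`isGroebnerBasis_toricIdeal`).

Let `m₂` be a good order for `G₂`. Order the monomials of the sum first by `degLex` in the edges
outside `G₂`, then by `m₂`. This induces some order `m₁` on `G₁`; there is no control over it, which
is where the UMG hypothesis enters. The union of the two reduced bases, for `m₁` and `m₂`, is the
reduced basis of the sum and a minimal generating set.

Gröbner: let two monomials of equal degree avoid all leading monomials of the union. Move the shared
edge to the `G₂` side. By bipartiteness, the degrees of the two remaining `G₁` parts differ by a
multiple of the shared edge vector (by zero if only a vertex is shared). Because the block order
compares outside degree first and the ideal is homogeneous, multiplying such a part by a power of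
the shared edge keeps it smallest (`IsToricGluing.isFiberMin_add`). Hence the `G₁` parts coincide,
and then so do the `G₂` parts.

Reduced and minimal: a power of the shared edge is alone in its fibre, so the nonzero binomials of
one side vanish when the variables private to that side are set to zero. Neither basis can then
replace or divide into the other. -/

open MvPolynomial

/-! ### Pulling back and restricting monomial orders. -/

section MonomialOrders

variable {σ : Type u} {τ : Type*}

/-- The monomial order pulled back along an injective additive map into a well-ordered
commutative monoid. -/
noncomputable def MonomialOrder.ofInjective {M : Type*} [AddCommMonoid M] [LinearOrder M]
    [IsOrderedAddMonoid M] [WellFoundedLT M] (f : (σ →₀ ℕ) →+ M)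
    (hf : Function.Injective f) (h0 : ∀ a, 0 ≤ f a) : MonomialOrder.{u, u} σ where
  syn := σ →₀ ℕ
  linearOrderSyn := LinearOrder.lift' f hf
  isOrderedAddMonoid_syn := by
    refine @IsOrderedAddMonoid.mk (σ →₀ ℕ) _ (LinearOrder.lift' f hf).toPartialOrder.toPreorder
      (fun a b h c => ?_) (fun a b h c => ?_)
    · change f (a + c) ≤ f (b + c)
      rw [map_add, map_add]
      exact add_le_add_left (show f a ≤ f b from h) _
    · change f (c + a) ≤ f (c + b)
      rw [map_add, map_add]
      exact add_le_add_right (show f a ≤ f b from h) _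
  toSyn := AddEquiv.refl _
  toSyn_monotone := by
    intro a b h
    change f a ≤ f b
    obtain ⟨c, rfl⟩ := exists_add_of_le h
    rw [map_add]
    exact le_add_of_nonneg_right (h0 c)
  wellFoundedLT_syn := by
    refine ⟨?_⟩
    exact InvImage.wf f (wellFounded_lt (α := M))

theorem MonomialOrder.ofInjective_le_iff {M : Type*} [AddCommMonoid M] [LinearOrder M]
    [IsOrderedAddMonoid M] [WellFoundedLT M] (f : (σ →₀ ℕ) →+ M)
    (hf : Function.Injective f) (h0 : ∀ a, 0 ≤ f a) (a b : σ →₀ ℕ) :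
    (MonomialOrder.ofInjective f hf h0).toSyn a ≤ (MonomialOrder.ofInjective f hf h0).toSyn b ↔
      f a ≤ f b :=
  Iff.rfl

/-- `m'` is the restriction of `m` along the inclusion `ι` of variables. -/
def MonomialOrder.IsRestriction (m : MonomialOrder τ) (m' : MonomialOrder σ) (ι : σ → τ) : Prop :=
  ∀ a b : σ →₀ ℕ, m.toSyn (a.mapDomain ι) ≤ m.toSyn (b.mapDomain ι) ↔ m'.toSyn a ≤ m'.toSyn b

theorem MonomialOrder.exists_isRestriction (m : MonomialOrder τ) {ι : σ → τ}
    (hι : Function.Injective ι) : ∃ m' : MonomialOrder.{u, u} σ, m.IsRestriction m' ι :=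
  ⟨MonomialOrder.ofInjective
    (m.toSyn.toAddMonoidHom.comp (Finsupp.mapDomain.addMonoidHom ι))
    (m.toSyn.injective.comp (Finsupp.mapDomain_injective hι))
    (fun _ => m.zero_le _), fun _ _ => Iff.rfl⟩

variable {K : Type*} [Field K] {m : MonomialOrder τ} {m' : MonomialOrder σ} {ι : σ → τ}

theorem MonomialOrder.IsRestriction.degree_rename (h : m.IsRestriction m' ι)
    (hι : Function.Injective ι) (f : MvPolynomial σ K) :
    m.degree (rename ι f) = (m'.degree f).mapDomain ι := by
  classical
  by_cases hf : f = 0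
  · simp [hf]
  apply m.toSyn.injective
  apply le_antisymm
  · rw [m.degree_le_iff]
    intro d hd
    rw [support_rename_of_injective hι, Finset.mem_image] at hd
    obtain ⟨d, hd, rfl⟩ := hd
    exact (h _ _).2 (m'.le_degree hd)
  · apply m.le_degree
    rw [support_rename_of_injective hι]
    exact Finset.mem_image_of_mem _ (m'.degree_mem_support hf)

theorem MonomialOrder.IsRestriction.leadingCoeff_rename (h : m.IsRestriction m' ι)
    (hι : Function.Injective ι) (f : MvPolynomial σ K) :
    m.leadingCoeff (rename ι f) = m'.leadingCoeff f := by
  rw [MonomialOrder.leadingCoeff, h.degree_rename hι, coeff_rename_mapDomain _ hι]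
  rfl

end MonomialOrders

/-! ### Multidegrees, fibres and Gröbner bases of toric ideals. -/

section ADegree

variable {V ι : Type*} (A : ι → V → ℕ)

theorem aDegree_zero : aDegree A 0 = 0 := Finsupp.sum_zero_index

theorem aDegree_add (a b : ι →₀ ℕ) : aDegree A (a + b) = aDegree A a + aDegree A b :=
  Finsupp.sum_add_index' (by simp) (by simp [add_smul])

theorem aDegree_single (i : ι) (n : ℕ) : aDegree A (Finsupp.single i n) = n • A i :=
  Finsupp.sum_single_index (by simp)

theorem aDegree_mapDomain {κ : Type*} (f : κ → ι) (a : κ →₀ ℕ) :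
    aDegree A (a.mapDomain f) = aDegree (A ∘ f) a :=
  Finsupp.sum_mapDomain_index (by simp) (by simp [add_smul])

theorem aDegree_apply (a : ι →₀ ℕ) (x : V) :
    aDegree A a x = a.sum fun i n => n * A i x := by
  simp [aDegree, Finsupp.sum, Finset.sum_apply]

end ADegree

section Toric

variable {K : Type*} [Field K] {V ι : Type*} {A : ι → V → ℕ}

theorem monomial_sub_monomial_mem_toricIdeal {a b : ι →₀ ℕ} (h : aDegree A a = aDegree A b) :
    (monomial a 1 - monomial b 1 : MvPolynomial ι K) ∈ toricIdeal K A :=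
  Ideal.subset_span ⟨a, b, h, rfl⟩

variable (K A) in
/-- The parametrization `x_i ↦ t ^ (A i)` of the toric variety. -/
noncomputable def toricMap : MvPolynomial ι K →ₐ[K] AddMonoidAlgebra K (V → ℕ) :=
  aeval fun i => AddMonoidAlgebra.single (A i) 1

theorem toricMap_monomial (a : ι →₀ ℕ) (c : K) :
    toricMap K A (monomial a c) = AddMonoidAlgebra.single (aDegree A a) c := by
  induction a using Finsupp.induction_linear generalizing c with
  | zero =>
    rw [aDegree_zero]
    exact (toricMap K A).commutes c
  | add f g hf hg =>
    rw [aDegree_add, ← mul_one c, ← monomial_mul, map_mul, hf, hg,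
      AddMonoidAlgebra.single_mul_single]
  | single i n =>
    rw [aDegree_single, ← C_mul_X_pow_eq_monomial, map_mul, map_pow, toricMap, aeval_X, aeval_C,
      AddMonoidAlgebra.single_pow, one_pow]
    change AddMonoidAlgebra.single 0 c * _ = _
    rw [AddMonoidAlgebra.single_mul_single, zero_add, mul_one]

theorem toricMap_eq_zero {f : MvPolynomial ι K} (hf : f ∈ toricIdeal K A) :
    toricMap K A f = 0 := by
  have : toricIdeal K A ≤ RingHom.ker (toricMap K A) := by
    rw [toricIdeal, Ideal.span_le]
    rintro _ ⟨a, b, h, rfl⟩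
    simp [toricMap_monomial, h]
  exact this hf

/-- The parametrization kills `f`, and its coefficient in a given degree is the sum of the
coefficients of `f` there; a lone term could not cancel. -/
theorem exists_ne_mem_support_of_mem_toricIdeal {f : MvPolynomial ι K}
    (hf : f ∈ toricIdeal K A) {a : ι →₀ ℕ} (ha : a ∈ f.support) :
    ∃ b ∈ f.support, b ≠ a ∧ aDegree A b = aDegree A a := by
  classical
  by_contra! hcon
  have h := toricMap_eq_zero hf
  rw [f.as_sum, map_sum] at h
  simp only [toricMap_monomial] at h
  have h2 := congrArg (fun g : AddMonoidAlgebra K (V → ℕ) => g.coeff (aDegree A a)) h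
  simp only [AddMonoidAlgebra.coeff_sum, AddMonoidAlgebra.coeff_single, Finsupp.finsetSum_apply,
    Finsupp.single_apply] at h2
  rw [Finset.sum_eq_single a] at h2
  · simp only [if_true] at h2
    exact mem_support_iff.1 ha h2
  · intro b hb hba
    rw [if_neg (hcon b hb hba)]
  · exact fun h => absurd ha h

/-- The monomial `x ^ a` is the smallest one of its `A`-degree. -/
def IsFiberMin (m : MonomialOrder ι) (A : ι → V → ℕ) (a : ι →₀ ℕ) : Prop :=
  ∀ b, aDegree A b = aDegree A a → m.toSyn a ≤ m.toSyn b

variable {m : MonomialOrder ι}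

/-- Multiplication by the cofactor preserves both fibres and the order, so a smaller competitor of
`a` would give one of `b`. -/
theorem IsFiberMin.of_le {a b : ι →₀ ℕ} (hb : IsFiberMin m A b) (h : a ≤ b) :
    IsFiberMin m A a := by
  obtain ⟨c, rfl⟩ := exists_add_of_le h
  intro d hd
  have := hb (d + c) (by rw [aDegree_add, aDegree_add, hd])
  rwa [map_add, map_add, add_le_add_iff_right] at this

theorem IsFiberMin.eq {a b : ι →₀ ℕ} (ha : IsFiberMin m A a) (hb : IsFiberMin m A b)
    (h : aDegree A a = aDegree A b) : a = b :=
  m.toSyn.injective (le_antisymm (ha b h.symm) (hb a h))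

variable (A m) in
theorem exists_isFiberMin (a : ι →₀ ℕ) :
    ∃ b, aDegree A b = aDegree A a ∧ IsFiberMin m A b := by
  have hwf : WellFounded fun x y : ι →₀ ℕ => m.toSyn x < m.toSyn y :=
    InvImage.wf m.toSyn wellFounded_lt
  obtain ⟨b, hb, hmin⟩ := hwf.has_min {b | aDegree A b = aDegree A a} ⟨a, rfl⟩
  exact ⟨b, hb, fun c hc => not_lt.1 (hmin c (hc.trans hb))⟩

theorem not_isFiberMin_degree {f : MvPolynomial ι K} (hf : f ∈ toricIdeal K A) (h0 : f ≠ 0) :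
    ¬ IsFiberMin m A (m.degree f) := by
  intro h
  obtain ⟨b, hb, hne, hab⟩ :=
    exists_ne_mem_support_of_mem_toricIdeal hf (m.degree_mem_support h0)
  exact hne (m.toSyn.injective (le_antisymm (m.le_degree hb) (h b hab)))

theorem degree_monomial_sub_monomial {a b : ι →₀ ℕ} (h : m.toSyn b < m.toSyn a) :
    m.degree (monomial a 1 - monomial b 1 : MvPolynomial ι K) = a := by
  classical
  rw [MonomialOrder.degree_sub_of_lt] <;> simp [MonomialOrder.degree_monomial, h]

theorem leadingCoeff_monomial_sub_monomial {a b : ι →₀ ℕ} (h : m.toSyn b < m.toSyn a) :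
    m.leadingCoeff (monomial a 1 - monomial b 1 : MvPolynomial ι K) = 1 := by
  classical
  rw [MonomialOrder.leadingCoeff_sub_of_lt] <;> simp [MonomialOrder.degree_monomial, h]

theorem IsFiberMin.exists_lt {a : ι →₀ ℕ} (h : ¬ IsFiberMin m A a) :
    ∃ b, aDegree A b = aDegree A a ∧ IsFiberMin m A b ∧ m.toSyn b < m.toSyn a := by
  obtain ⟨b, hb, hmin⟩ := exists_isFiberMin A m a
  refine ⟨b, hb, hmin, lt_of_le_of_ne (hmin a hb.symm) fun heq => h ?_⟩
  rwa [← m.toSyn.injective heq]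

/-- The binomial of `x ^ a` and the smallest monomial of its fibre lies in the ideal and has leading
monomial `x ^ a`. -/
theorem IsGroebnerBasis.exists_degree_le {S : Set (MvPolynomial ι K)}
    (hS : IsGroebnerBasis m (toricIdeal K A) S) (h1 : ∀ p ∈ S, m.leadingCoeff p = 1)
    {a : ι →₀ ℕ} (ha : ¬ IsFiberMin m A a) : ∃ p ∈ S, m.degree p ≤ a := by
  classical
  obtain ⟨b, hb, -, hlt⟩ := IsFiberMin.exists_lt ha
  have hmem : (monomial a 1 : MvPolynomial ι K) ∈ Ideal.span (m.leadingTerm '' S) := by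
    rw [hS.span_leadingTerm]
    refine Ideal.subset_span ⟨_, monomial_sub_monomial_mem_toricIdeal hb.symm, ?_⟩
    rw [MonomialOrder.leadingTerm, degree_monomial_sub_monomial hlt,
      leadingCoeff_monomial_sub_monomial hlt]
  rw [MonomialOrder.span_leadingTerm_eq_span_monomial (fun p hp => by simp [h1 p hp]),
    ← Set.image_image (fun s => monomial s (1 : K)) m.degree,
    mem_ideal_span_monomial_image] at hmem
  obtain ⟨_, ⟨p, hp, rfl⟩, hle⟩ := hmem a (by simp [mem_support_iff])
  exact ⟨p, hp, hle⟩

theorem isGroebnerBasis_toricIdeal {S : Set (MvPolynomial ι K)} (hfin : S.Finite)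
    (hsub : S ⊆ toricIdeal K A) (h1 : ∀ p ∈ S, m.leadingCoeff p = 1)
    (h : ∀ a, ¬ IsFiberMin m A a → ∃ p ∈ S, m.degree p ≤ a) :
    IsGroebnerBasis m (toricIdeal K A) S where
  finite := hfin
  subset := hsub
  span_leadingTerm := by
    apply le_antisymm (Ideal.span_mono (Set.image_mono hsub))
    rw [Ideal.span_le]
    rintro _ ⟨f, hf, rfl⟩
    by_cases h0 : f = 0
    · simp [h0]
    obtain ⟨p, hp, hle⟩ := h _ (not_isFiberMin_degree hf h0)
    rw [SetLike.mem_coe,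
      MonomialOrder.span_leadingTerm_eq_span_monomial (fun p hp => by simp [h1 p hp]),
      ← Set.image_image (fun s => monomial s (1 : K)) m.degree,
      mem_ideal_span_monomial_image]
    intro d hd
    rw [m.support_leadingTerm' h0, Finset.mem_singleton] at hd
    exact ⟨_, ⟨p, hp, rfl⟩, hd ▸ hle⟩

/-- A nonzero remainder on division by `S` would lie in the ideal, so its leading monomial would be
divisible by one of `S`. -/
theorem IsGroebnerBasis.span_eq_toricIdeal {S : Set (MvPolynomial ι K)}
    (hS : IsGroebnerBasis m (toricIdeal K A) S) (h1 : ∀ p ∈ S, m.leadingCoeff p = 1) :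
    Ideal.span S = toricIdeal K A := by
  apply le_antisymm (Ideal.span_le.2 hS.subset)
  intro f hf
  obtain ⟨g, r, hfr, -, hr⟩ := m.div_set (B := S) (fun p hp => by simp [h1 p hp]) f
  have hg : Finsupp.linearCombination (MvPolynomial ι K)
      (fun b : S => (b : MvPolynomial ι K)) g ∈ Ideal.span S := by
    rw [Finsupp.linearCombination_apply]
    exact Ideal.sum_mem _ fun p _ => Ideal.mul_mem_left _ _ (Ideal.subset_span p.2)
  have hrI : r ∈ toricIdeal K A := by
    rw [← sub_eq_of_eq_add' hfr]
    exact sub_mem hf (Ideal.span_le.2 hS.subset hg)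
  have hr0 : r = 0 := by
    by_contra h0
    obtain ⟨p, hp, hle⟩ := hS.exists_degree_le h1 (not_isFiberMin_degree hrI h0)
    exact hr _ (m.degree_mem_support h0) p hp hle
  rw [hfr, hr0, add_zero]
  exact hg

variable (K A m) in
-- Dickson's lemma: the non-smallest monomials have finitely many minimal elements. Each is paired
-- with the smallest monomial of its fibre, which no leading monomial divides.
theorem exists_isReducedGroebnerBasis [Finite ι] :
    ∃ S, IsReducedGroebnerBasis m (toricIdeal K A) S := by
  classical
  set N : Set (ι →₀ ℕ) := {a | ¬ IsFiberMin m A a} with hN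
  set B : Set (ι →₀ ℕ) := {a | Minimal (· ∈ N) a} with hB
  have hBfin : B.Finite := by
    have hanti : IsAntichain (· ≤ ·) B := setOfPred_minimal_antichain _
    exact WellQuasiOrderedLE.finite_of_isAntichain hanti
  choose! nf hnf using fun (a : ι →₀ ℕ) (h : a ∈ N) => IsFiberMin.exists_lt h
  set q : (ι →₀ ℕ) → MvPolynomial ι K := fun a => monomial a 1 - monomial (nf a) 1 with hq
  have hdeg : ∀ a ∈ N, m.degree (q a) = a := fun a ha =>
    degree_monomial_sub_monomial (hnf a ha).2.2
  have h1 : ∀ p ∈ q '' B, m.leadingCoeff p = 1 := by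
    rintro _ ⟨a, ha, rfl⟩
    exact leadingCoeff_monomial_sub_monomial (hnf a ha.prop).2.2
  refine ⟨q '' B, ⟨isGroebnerBasis_toricIdeal (hBfin.image _) ?_ h1 ?_, h1, ?_⟩⟩
  · rintro _ ⟨a, ha, rfl⟩
    exact monomial_sub_monomial_mem_toricIdeal (hnf a ha.prop).1.symm
  · intro a ha
    obtain ⟨b, hba, hb⟩ := exists_minimal_le_of_wellFoundedLT (· ∈ N) a ha
    exact ⟨q b, ⟨b, hb, rfl⟩, by rwa [hdeg b hb.prop]⟩
  · rintro _ ⟨a, ha, rfl⟩ _ ⟨b, hb, rfl⟩ hne d hd hle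
    rw [hdeg b hb.prop] at hle
    have hd' : d = a ∨ d = nf a := by
      by_contra! hcon
      rw [mem_support_iff] at hd
      simp [hq, coeff_monomial, hcon.1.symm, hcon.2.symm] at hd
    rcases hd' with rfl | rfl
    · exact hne (by rw [ha.eq_of_ge hb.prop hle])
    · exact hb.prop ((hnf a ha.prop).2.1.of_le hle)

end Toric

/-! ### Exponent vectors under inclusion of variables. -/

section FinsuppMap

variable {σ τ : Type*} {ι : σ → τ}

theorem Finsupp.mapDomain_comapDomain_le (hι : Function.Injective ι) (a : τ →₀ ℕ) :
    (a.comapDomain ι hι.injOn).mapDomain ι ≤ a := by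
  intro t
  by_cases ht : t ∈ Set.range ι
  · obtain ⟨i, rfl⟩ := ht
    rw [Finsupp.mapDomain_apply hι, Finsupp.comapDomain_apply]
  · rw [Finsupp.mapDomain_of_notMem_range _ _ ht]
    exact Nat.zero_le _

theorem Finsupp.filter_le_self (p : σ → Prop) [DecidablePred p] (a : σ →₀ ℕ) :
    a.filter p ≤ a := by
  intro i
  rw [Finsupp.filter_apply]
  split_ifs <;> simp

theorem Finsupp.of_mem_support_filter {p : σ → Prop} [DecidablePred p] {a : σ →₀ ℕ} {i : σ}
    (h : i ∈ (a.filter p).support) : p i := by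
  by_contra hp
  exact Finsupp.mem_support_iff.1 h (Finsupp.filter_apply_neg _ _ hp)

theorem Finsupp.degree_eq_apply {a : σ →₀ ℕ} {i : σ} (h : ∀ j ∈ a.support, j = i) :
    a.degree = a i := by
  rw [Finsupp.degree_apply]
  exact Finset.sum_eq_single i (fun j hj hne => absurd (h j hj) hne) (fun h => by simpa using h)

end FinsuppMap

/-! ### The block order and the abstract form of gluing. -/

/-- A block order on `τ` comparing first the total degree in the variables outside the range of
`κ`, and restricting to a given order on the variables in the range of `κ`. -/
theorem MonomialOrder.exists_block {τ : Type u} [Finite τ] {σ : Type*} {κ : σ → τ}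
    (hκ : Function.Injective κ) (m₂ : MonomialOrder σ) :
    ∃ m : MonomialOrder.{u, u} τ, m.IsRestriction m₂ κ ∧ ∀ a b : τ →₀ ℕ, m.toSyn a ≤ m.toSyn b →
      (a.subtypeDomain (· ∉ Set.range κ)).degree ≤ (b.subtypeDomain (· ∉ Set.range κ)).degree := by
  classical
  -- `degLex` needs a linear order on the outside variables; any one will do.
  obtain ⟨n, ⟨e⟩⟩ := Finite.exists_equiv_fin {t : τ // t ∉ Set.range κ}
  let : LinearOrder {t : τ // t ∉ Set.range κ} := LinearOrder.lift' e e.injective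
  set d : MonomialOrder {t : τ // t ∉ Set.range κ} := MonomialOrder.degLex
  let f : (τ →₀ ℕ) →+ d.syn ×ₗ m₂.syn :=
    { toFun := fun a => toLex (d.toSyn (a.subtypeDomain (· ∉ Set.range κ)),
        m₂.toSyn (a.comapDomain κ hκ.injOn))
      map_zero' := by
        rw [Finsupp.subtypeDomain_zero, Finsupp.comapDomain_zero, map_zero, map_zero]; rfl
      map_add' := fun a b => by
        rw [Finsupp.subtypeDomain_add, Finsupp.comapDomain_add_of_injective hκ, map_add, map_add]
        rfl }
  have hf : Function.Injective f := by
    intro a b hab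
    have h := Prod.ext_iff.1 (toLex.injective hab)
    have h1 := d.toSyn.injective h.1
    have h2 := m₂.toSyn.injective h.2
    ext t
    by_cases ht : t ∈ Set.range κ
    · obtain ⟨i, rfl⟩ := ht
      simpa using DFunLike.congr_fun h2 i
    · simpa using DFunLike.congr_fun h1 ⟨t, ht⟩
  have h0 : ∀ a, 0 ≤ f a := by
    intro a
    rw [← map_zero f]
    refine Prod.Lex.toLex_mono (Prod.mk_le_mk.2 ⟨?_, ?_⟩)
    · rw [Finsupp.subtypeDomain_zero, map_zero]
      exact d.zero_le _
    · rw [Finsupp.comapDomain_zero, map_zero]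
      exact m₂.zero_le _
  refine ⟨MonomialOrder.ofInjective f hf h0, ?_, ?_⟩
  · intro a b
    rw [MonomialOrder.ofInjective_le_iff]
    have hs : ∀ c : σ →₀ ℕ, f (c.mapDomain κ) = toLex (0, m₂.toSyn c) := by
      intro c
      refine congrArg toLex (Prod.ext ?_ ?_)
      · have : (c.mapDomain κ).subtypeDomain (· ∉ Set.range κ) = 0 := by
          ext t
          simp [Finsupp.mapDomain_of_notMem_range _ _ t.2]
        simp only [this, map_zero]
      · simp only [Finsupp.comapDomain_mapDomain _ hκ]
    rw [hs, hs, Prod.Lex.toLex_le_toLex]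
    simp
  · intro a b hab
    rw [MonomialOrder.ofInjective_le_iff] at hab
    have h := (Prod.Lex.toLex_le_toLex.1 hab)
    have hle : d.toSyn (a.subtypeDomain (· ∉ Set.range κ)) ≤
        d.toSyn (b.subtypeDomain (· ∉ Set.range κ)) := by
      rcases h with h | h
      · exact h.le
      · exact h.1.le
    exact Finsupp.DegLex.monotone_degree hle

/-- The configuration `A`, indexed by `τ`, is glued from `A₁` and `A₂` along at most one common
index, and the degrees contributed by the two parts can differ only by a multiple of the
common vector. -/
structure IsToricGluing {σ₁ σ₂ τ V₁ V₂ W : Type*} (A₁ : σ₁ → V₁ → ℕ) (A₂ : σ₂ → V₂ → ℕ)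
    (A : τ → W → ℕ) (ι₁ : σ₁ → τ) (ι₂ : σ₂ → τ) : Prop where
  inj₁ : Function.Injective ι₁
  inj₂ : Function.Injective ι₂
  surj : ∀ t, t ∈ Set.range ι₁ ∨ t ∈ Set.range ι₂
  subsingleton : ∀ i j, ι₁ i ∈ Set.range ι₂ → ι₁ j ∈ Set.range ι₂ → i = j
  aDegree₁ : ∀ a b : σ₁ →₀ ℕ,
    aDegree A (a.mapDomain ι₁) = aDegree A (b.mapDomain ι₁) ↔ aDegree A₁ a = aDegree A₁ b
  aDegree₂ : ∀ a b : σ₂ →₀ ℕ,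
    aDegree A (a.mapDomain ι₂) = aDegree A (b.mapDomain ι₂) ↔ aDegree A₂ a = aDegree A₂ b
  homogeneous : ∀ a b : σ₁ →₀ ℕ, aDegree A₁ a = aDegree A₁ b → a.degree = b.degree
  -- A power of the common variable is alone in its fibre.
  fiber₁ : ∀ a b : σ₁ →₀ ℕ, (∀ i ∈ a.support, ι₁ i ∈ Set.range ι₂) →
    aDegree A₁ a = aDegree A₁ b → a = b
  fiber₂ : ∀ a b : σ₂ →₀ ℕ, (∀ i ∈ a.support, ι₂ i ∈ Set.range ι₁) →
    aDegree A₂ a = aDegree A₂ b → a = b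
  -- `c` is a power of the common variable; exponents are natural, so it is added to whichever side
  -- lacks it.
  split : ∀ (a₁ b₁ : σ₁ →₀ ℕ) (a₂ b₂ : σ₂ →₀ ℕ),
    aDegree A (a₁.mapDomain ι₁ + a₂.mapDomain ι₂) =
      aDegree A (b₁.mapDomain ι₁ + b₂.mapDomain ι₂) →
    ∃ c : σ₁ →₀ ℕ, (∀ i ∈ c.support, ι₁ i ∈ Set.range ι₂) ∧
      (aDegree A₁ (a₁ + c) = aDegree A₁ b₁ ∨ aDegree A₁ a₁ = aDegree A₁ (b₁ + c))

/-! ### Interaction of the two bases inside the larger ring. -/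

section Rename

variable {K : Type*} [Field K] {σ σ' τ V V' W : Type*} {B : σ → V → ℕ} {B' : σ' → V' → ℕ}
  {A : τ → W → ℕ} {ι : σ → τ} {κ : σ' → τ}

theorem rename_mem_toricIdeal (h : ∀ a b : σ →₀ ℕ, aDegree B a = aDegree B b →
    aDegree A (a.mapDomain ι) = aDegree A (b.mapDomain ι)) {p : MvPolynomial σ K}
    (hp : p ∈ toricIdeal K B) : rename ι p ∈ toricIdeal K A := by
  have : toricIdeal K B ≤ (toricIdeal K A).comap (rename ι) := by
    rw [toricIdeal, Ideal.span_le]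
    rintro _ ⟨a, b, hab, rfl⟩
    simp only [SetLike.mem_coe, Ideal.mem_comap, map_sub, rename_monomial]
    exact monomial_sub_monomial_mem_toricIdeal (h a b hab)
  exact this hp

theorem killCompl_rename_monomial_eq_zero (hι : Function.Injective ι) {b : σ' →₀ ℕ} {i : σ'}
    (hi : i ∈ b.support) (h : κ i ∉ Set.range ι) :
    killCompl hι (rename κ (monomial b (1 : K))) = 0 := by
  rw [killCompl, aeval_rename, aeval_monomial, Finsupp.prod,
    Finset.prod_eq_zero hi, mul_zero]
  simp only [Function.comp_apply]
  rw [dif_neg h, zero_pow (Finsupp.mem_support_iff.1 hi)]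

/-- For a generating binomial, either a monomial uses only common variables, and then the two are
equal, or each contains a variable that is set to zero. -/
theorem killCompl_rename_eq_zero (hι : Function.Injective ι)
    (hfib : ∀ a b : σ' →₀ ℕ, (∀ i ∈ a.support, κ i ∈ Set.range ι) →
      aDegree B' a = aDegree B' b → a = b)
    {p : MvPolynomial σ' K} (hp : p ∈ toricIdeal K B') : killCompl hι (rename κ p) = 0 := by
  have : toricIdeal K B' ≤
      RingHom.ker ((killCompl hι).comp (rename κ : MvPolynomial σ' K →ₐ[K] MvPolynomial τ K)) := by
    rw [toricIdeal, Ideal.span_le]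
    rintro _ ⟨a, b, hab, rfl⟩
    rw [SetLike.mem_coe, RingHom.mem_ker, map_sub, AlgHom.comp_apply, AlgHom.comp_apply]
    by_cases ha : ∀ i ∈ a.support, κ i ∈ Set.range ι
    · rw [hfib a b ha hab, sub_self]
    by_cases hb : ∀ i ∈ b.support, κ i ∈ Set.range ι
    · rw [hfib b a hb hab.symm, sub_self]
    push Not at ha hb
    obtain ⟨i, hi, hi'⟩ := ha
    obtain ⟨j, hj, hj'⟩ := hb
    rw [killCompl_rename_monomial_eq_zero hι hi hi', killCompl_rename_monomial_eq_zero hι hj hj',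
      sub_zero]
  exact this hp

/-- Setting the variables outside the range of `ι` to zero fixes `S` and kills `S'`. If `p` were
missing from `T`, then `S \ {p}` would already generate. -/
theorem rename_mem_of_span_eq (hι : Function.Injective ι)
    (hdeg : ∀ a b : σ →₀ ℕ, aDegree B a = aDegree B b →
      aDegree A (a.mapDomain ι) = aDegree A (b.mapDomain ι))
    (hfib : ∀ a b : σ' →₀ ℕ, (∀ i ∈ a.support, κ i ∈ Set.range ι) →
      aDegree B' a = aDegree B' b → a = b)
    {S : Set (MvPolynomial σ K)} {S' : Set (MvPolynomial σ' K)}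
    (hS : IsMinimalGeneratingSet (toricIdeal K B) S) (hS' : S' ⊆ toricIdeal K B')
    {T : Set (MvPolynomial τ K)} (hT : T ⊆ rename ι '' S ∪ rename κ '' S')
    (hspan : Ideal.span T = toricIdeal K A) {p : MvPolynomial σ K} (hp : p ∈ S) :
    rename ι p ∈ T := by
  by_contra hpT
  have hkill : ∀ q : MvPolynomial σ K, killCompl hι (rename ι q) = q := fun q =>
    DFunLike.congr_fun (killCompl_comp_rename hι) q
  refine hS.2 (S \ {p}) ⟨Set.sdiff_subset, fun h => (h hp).2 rfl⟩ (le_antisymm ?_ ?_)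
  · rw [← hS.1]
    exact Ideal.span_mono Set.sdiff_subset
  · intro q hq
    have hq' : rename ι q ∈ Ideal.span T := hspan ▸ rename_mem_toricIdeal hdeg hq
    have hle : Ideal.span T ≤ (Ideal.span (S \ {p})).comap (killCompl hι) := by
      rw [Ideal.span_le]
      intro t ht
      rw [SetLike.mem_coe, Ideal.mem_comap]
      rcases hT ht with ⟨s, hs, rfl⟩ | ⟨s, hs, rfl⟩
      · rw [hkill]
        refine Ideal.subset_span ⟨hs, fun h => hpT ?_⟩
        rw [Set.mem_singleton_iff] at h
        rwa [h] at ht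
      · rw [killCompl_rename_eq_zero hι hfib (hS' hs)]
        exact zero_mem _
    have := hle hq'
    rwa [Ideal.mem_comap, hkill] at this

/-- A divisor of a monomial from the other part uses only common variables, so it is alone in its
fibre; a leading monomial never is. -/
theorem not_degree_rename_le_mapDomain {m' : MonomialOrder σ'} {m : MonomialOrder τ}
    (hm : m.IsRestriction m' κ) (hκ : Function.Injective κ)
    (hfib : ∀ a b : σ' →₀ ℕ, (∀ i ∈ a.support, κ i ∈ Set.range ι) →
      aDegree B' a = aDegree B' b → a = b)
    {q : MvPolynomial σ' K} (hq : q ∈ toricIdeal K B') (h0 : q ≠ 0) (d : σ →₀ ℕ) :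
    ¬ m.degree (rename κ q) ≤ d.mapDomain ι := by
  intro hle
  rw [hm.degree_rename hκ] at hle
  refine not_isFiberMin_degree (m := m') hq h0 fun b hb => (congrArg _ (hfib _ b ?_ hb.symm)).le
  intro i hi
  by_contra hcon
  have := hle (κ i)
  rw [Finsupp.mapDomain_apply hκ, Finsupp.mapDomain_of_notMem_range _ _ hcon] at this
  exact Finsupp.mem_support_iff.1 hi (Nat.le_zero.1 this)

theorem isFiberMin_comapDomain {m' : MonomialOrder σ} {m : MonomialOrder τ}
    (hm : m.IsRestriction m' ι) (hι : Function.Injective ι) {S : Set (MvPolynomial σ K)}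
    (hS : IsReducedGroebnerBasis m' (toricIdeal K B) S) {a : τ →₀ ℕ}
    (ha : ∀ p ∈ S, ¬ m.degree (rename ι p) ≤ a) :
    IsFiberMin m' B (a.comapDomain ι hι.injOn) := by
  by_contra hcon
  obtain ⟨p, hp, hle⟩ := hS.exists_degree_le hS.leadingCoeff_eq_one hcon
  refine ha p hp ?_
  rw [hm.degree_rename hι]
  exact (Finsupp.mapDomain_mono hle).trans (Finsupp.mapDomain_comapDomain_le hι a)

theorem not_le_support_rename {m' : MonomialOrder σ} {m : MonomialOrder τ}
    (hm : m.IsRestriction m' ι) (hι : Function.Injective ι) {S : Set (MvPolynomial σ K)}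
    (hS : IsReducedGroebnerBasis m' (toricIdeal K B) S) {p q : MvPolynomial σ K} (hp : p ∈ S)
    (hq : q ∈ S) (hne : rename ι q ≠ rename ι p) {d : τ →₀ ℕ} (hd : d ∈ (rename ι p).support) :
    ¬ m.degree (rename ι q) ≤ d := by
  classical
  rw [support_rename_of_injective hι, Finset.mem_image] at hd
  obtain ⟨d, hd, rfl⟩ := hd
  rw [hm.degree_rename hι]
  intro hle
  refine hS.not_dvd p hp q hq (fun h => hne (by rw [h])) d hd fun i => ?_
  simpa [Finsupp.mapDomain_apply hι] using hle (ι i)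

end Rename

/-! ### Uniqueness of standard monomials, and the gluing theorem. -/

section Gluing

variable {K : Type*} [Field K] {σ₁ : Type u} {σ₂ τ V₁ V₂ W : Type*} {A₁ : σ₁ → V₁ → ℕ}
  {A₂ : σ₂ → V₂ → ℕ} {A : τ → W → ℕ} {ι₁ : σ₁ → τ} {ι₂ : σ₂ → τ}

/-- Multiplying by common variables preserves minimality in the fibre. -/
theorem IsToricGluing.isFiberMin_add (hg : IsToricGluing A₁ A₂ A ι₁ ι₂) {m : MonomialOrder τ}
    {m₁ : MonomialOrder σ₁} (hm₁ : m.IsRestriction m₁ ι₁)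
    (hblock : ∀ a b : τ →₀ ℕ, m.toSyn a ≤ m.toSyn b →
      (a.subtypeDomain (· ∉ Set.range ι₂)).degree ≤ (b.subtypeDomain (· ∉ Set.range ι₂)).degree)
    {a c : σ₁ →₀ ℕ} (ha : IsFiberMin m₁ A₁ a) (ha' : ∀ i ∈ a.support, ι₁ i ∉ Set.range ι₂)
    (hc : ∀ i ∈ c.support, ι₁ i ∈ Set.range ι₂) : IsFiberMin m₁ A₁ (a + c) := by
  classical
  have hzero : ∀ y : σ₁ →₀ ℕ, (∀ i ∈ y.support, ι₁ i ∈ Set.range ι₂) →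
      (y.mapDomain ι₁).subtypeDomain (· ∉ Set.range ι₂) = 0 := by
    intro y hy
    ext ⟨t, ht⟩
    rw [Finsupp.subtypeDomain_apply, Finsupp.zero_apply]
    by_contra hne
    obtain ⟨i, hi, rfl⟩ := Finset.mem_image.1
      (Finsupp.mapDomain_support (Finsupp.mem_support_iff.2 hne))
    exact ht (hy i hi)
  have hfull : ∀ x : σ₁ →₀ ℕ, (∀ i ∈ x.support, ι₁ i ∉ Set.range ι₂) →
      ((x.mapDomain ι₁).subtypeDomain (· ∉ Set.range ι₂)).degree = x.degree := by
    intro x hx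
    rw [← Finsupp.degree_mapDomain ι₁ x]
    simp only [Finsupp.degree_apply, Finsupp.support_subtypeDomain, Finsupp.subtypeDomain_apply]
    rw [Finset.sum_subtype_of_mem (fun t => (x.mapDomain ι₁) t)]
    intro t ht
    obtain ⟨i, hi, rfl⟩ := Finset.mem_image.1 (Finsupp.mapDomain_support ht)
    exact hx i hi
  intro x hx
  -- Split a smaller competitor `x` into its private part `x₁` and its common part `y`. The block
  -- order bounds the degree of `x₁` by that of `a`.
  by_contra! hlt
  set x₁ := x.filter fun i => ι₁ i ∉ Set.range ι₂ with hx₁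
  set y := x.filter fun i => ¬ ι₁ i ∉ Set.range ι₂ with hy
  have hxy : x₁ + y = x := Finsupp.filter_add_filter_not x _
  have hx₁s : ∀ i ∈ x₁.support, ι₁ i ∉ Set.range ι₂ := fun i hi =>
    Finsupp.of_mem_support_filter (p := fun i => ι₁ i ∉ Set.range ι₂) hi
  have hys : ∀ i ∈ y.support, ι₁ i ∈ Set.range ι₂ := fun i hi => not_not.1
    (Finsupp.of_mem_support_filter (p := fun i => ¬ ι₁ i ∉ Set.range ι₂) hi)
  have hd1 : x₁.degree ≤ a.degree := by
    have := hblock _ _ ((hm₁ _ _).2 hlt.le)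
    rwa [← hxy, Finsupp.mapDomain_add, Finsupp.mapDomain_add, Finsupp.subtypeDomain_add,
      Finsupp.subtypeDomain_add, hzero y hys, hzero c hc, add_zero, add_zero, hfull _ hx₁s,
      hfull _ ha'] at this
  have hd2 := hg.homogeneous _ _ hx
  rw [← hxy, map_add, map_add] at hd2
  -- Homogeneity turns the bound on `x₁` into `c.degree ≤ y.degree`; both live on at most one index,
  -- so degrees are exponents. Cancelling `c` then contradicts minimality of `a`.
  have hcy : c ≤ y := by
    intro i
    by_cases hi : i ∈ c.support
    · have hval : ∀ z : σ₁ →₀ ℕ, (∀ j ∈ z.support, ι₁ j ∈ Set.range ι₂) → z.degree = z i :=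
        fun z hz => Finsupp.degree_eq_apply fun j hj => hg.subsingleton _ _ (hz j hj) (hc i hi)
      rw [← hval c hc, ← hval y hys]
      omega
    · rw [Finsupp.notMem_support_iff.1 hi]
      exact Nat.zero_le _
  obtain ⟨w, hw⟩ := exists_add_of_le hcy
  have hxw : x = (x₁ + w) + c := by rw [← hxy, hw]; abel
  rw [hxw, aDegree_add, aDegree_add A₁ a c] at hx
  have := ha _ (add_right_cancel hx)
  rw [hxw, map_add, map_add m₁.toSyn a c] at hlt
  exact absurd (lt_of_add_lt_add_right hlt) this.not_gt

/-- A monomial of the glued configuration whose two parts are minimal in their fibres is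
determined by its degree. -/
theorem IsToricGluing.eq_of_isFiberMin (hg : IsToricGluing A₁ A₂ A ι₁ ι₂) {m : MonomialOrder τ}
    {m₁ : MonomialOrder σ₁} {m₂ : MonomialOrder σ₂} (hm₁ : m.IsRestriction m₁ ι₁)
    (hblock : ∀ a b : τ →₀ ℕ, m.toSyn a ≤ m.toSyn b →
      (a.subtypeDomain (· ∉ Set.range ι₂)).degree ≤ (b.subtypeDomain (· ∉ Set.range ι₂)).degree)
    {a b : τ →₀ ℕ} (ha₁ : IsFiberMin m₁ A₁ (a.comapDomain ι₁ hg.inj₁.injOn))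
    (hb₁ : IsFiberMin m₁ A₁ (b.comapDomain ι₁ hg.inj₁.injOn))
    (ha₂ : IsFiberMin m₂ A₂ (a.comapDomain ι₂ hg.inj₂.injOn))
    (hb₂ : IsFiberMin m₂ A₂ (b.comapDomain ι₂ hg.inj₂.injOn))
    (hab : aDegree A a = aDegree A b) : a = b := by
  classical
  -- The common variable is counted with the second part only.
  let off : (τ →₀ ℕ) → (σ₁ →₀ ℕ) := fun x =>
    (x.comapDomain ι₁ hg.inj₁.injOn).filter fun i => ι₁ i ∉ Set.range ι₂
  have hoff : ∀ x, ∀ i ∈ (off x).support, ι₁ i ∉ Set.range ι₂ := fun x i hi =>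
    Finsupp.of_mem_support_filter (p := fun i => ι₁ i ∉ Set.range ι₂) hi
  have hdec : ∀ x : τ →₀ ℕ,
      (off x).mapDomain ι₁ + (x.comapDomain ι₂ hg.inj₂.injOn).mapDomain ι₂ = x := by
    intro x
    ext t
    rw [Finsupp.add_apply]
    by_cases ht : t ∈ Set.range ι₂
    · obtain ⟨j, rfl⟩ := ht
      rw [Finsupp.mapDomain_apply hg.inj₂, Finsupp.comapDomain_apply]
      suffices h : (off x).mapDomain ι₁ (ι₂ j) = 0 by rw [h, zero_add]
      by_contra hne
      obtain ⟨i, hi, hij⟩ := Finset.mem_image.1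
        (Finsupp.mapDomain_support (Finsupp.mem_support_iff.2 hne))
      exact hoff x i hi ⟨j, hij.symm⟩
    · obtain ⟨i, rfl⟩ := (hg.surj t).resolve_right ht
      rw [Finsupp.mapDomain_of_notMem_range _ _ ht, Finsupp.mapDomain_apply hg.inj₁, add_zero]
      exact Finsupp.filter_apply_pos (fun i => ι₁ i ∉ Set.range ι₂) _ ht
  -- `p + c` and `q` are both smallest in one fibre, hence equal; `q` is free of the common
  -- variable, so `c = 0`.
  have key : ∀ (p q c : σ₁ →₀ ℕ), IsFiberMin m₁ A₁ p → IsFiberMin m₁ A₁ q →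
      (∀ i ∈ p.support, ι₁ i ∉ Set.range ι₂) → (∀ i ∈ q.support, ι₁ i ∉ Set.range ι₂) →
      (∀ i ∈ c.support, ι₁ i ∈ Set.range ι₂) → aDegree A₁ (p + c) = aDegree A₁ q → p = q := by
    intro p q c hp hq hps hqs hcs hpq
    have h := (hg.isFiberMin_add hm₁ hblock hp hps hcs).eq hq hpq
    have hc0 : c = 0 := by
      ext i
      by_contra hi
      refine hqs i ?_ (hcs i (Finsupp.mem_support_iff.2 hi))
      rw [← h, Finsupp.mem_support_iff, Finsupp.add_apply]
      exact fun h0 => hi (Nat.add_eq_zero_iff.1 h0).2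
    rw [← h, hc0, add_zero]
  have hmin_a : IsFiberMin m₁ A₁ (off a) := ha₁.of_le (Finsupp.filter_le_self _ _)
  have hmin_b : IsFiberMin m₁ A₁ (off b) := hb₁.of_le (Finsupp.filter_le_self _ _)
  have hab' := hab
  rw [← hdec a, ← hdec b] at hab'
  have hoffeq : off a = off b := by
    obtain ⟨c, hc, h | h⟩ := hg.split _ _ _ _ hab'
    · exact key _ _ c hmin_a hmin_b (hoff a) (hoff b) hc h
    · exact (key _ _ c hmin_b hmin_a (hoff b) (hoff a) hc h.symm).symm
  rw [aDegree_add, aDegree_add, hoffeq] at hab'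
  have h2 := ha₂.eq hb₂ ((hg.aDegree₂ _ _).1 (add_left_cancel hab'))
  rw [← hdec a, ← hdec b, hoffeq, h2]

end Gluing

theorem IsToricGluing.isMGIdeal {K : Type*} [Field K] {σ₁ σ₂ τ V₁ V₂ W : Type*}
    [Finite σ₁] [Finite τ] {A₁ : σ₁ → V₁ → ℕ} {A₂ : σ₂ → V₂ → ℕ} {A : τ → W → ℕ}
    {ι₁ : σ₁ → τ} {ι₂ : σ₂ → τ} (hg : IsToricGluing A₁ A₂ A ι₁ ι₂)
    (h₁ : IsUMGIdeal (toricIdeal K A₁)) (h₂ : IsMGIdeal (toricIdeal K A₂)) :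
    IsMGIdeal (toricIdeal K A) := by
  obtain ⟨m₂, S₂, hS₂, hmin₂⟩ := h₂
  obtain ⟨m, hm₂, hblock⟩ := MonomialOrder.exists_block hg.inj₂ m₂
  obtain ⟨m₁, hm₁⟩ := m.exists_isRestriction hg.inj₁
  obtain ⟨S₁, hS₁⟩ := exists_isReducedGroebnerBasis K A₁ m₁
  have hmin₁ := h₁ m₁ S₁ hS₁
  have hd₁ := fun a b => (hg.aDegree₁ a b).2
  have hd₂ := fun a b => (hg.aDegree₂ a b).2
  have hne₁ : ∀ p ∈ S₁, p ≠ 0 := by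
    rintro p hp rfl
    simpa using hS₁.leadingCoeff_eq_one 0 hp
  have hne₂ : ∀ p ∈ S₂, p ≠ 0 := by
    rintro p hp rfl
    simpa using hS₂.leadingCoeff_eq_one 0 hp
  set S : Set (MvPolynomial τ K) := rename ι₁ '' S₁ ∪ rename ι₂ '' S₂ with hS
  have hlc : ∀ p ∈ S, m.leadingCoeff p = 1 := by
    rintro _ (⟨p, hp, rfl⟩ | ⟨p, hp, rfl⟩)
    · rw [hm₁.leadingCoeff_rename hg.inj₁, hS₁.leadingCoeff_eq_one p hp]
    · rw [hm₂.leadingCoeff_rename hg.inj₂, hS₂.leadingCoeff_eq_one p hp]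
  have hGB : IsGroebnerBasis m (toricIdeal K A) S := by
    refine isGroebnerBasis_toricIdeal ((hS₁.finite.image _).union (hS₂.finite.image _)) ?_ hlc ?_
    · rintro _ (⟨p, hp, rfl⟩ | ⟨p, hp, rfl⟩)
      · exact rename_mem_toricIdeal hd₁ (hS₁.subset hp)
      · exact rename_mem_toricIdeal hd₂ (hS₂.subset hp)
    · intro a ha
      by_contra! hcon
      -- If no leading monomial divides `a`, the smallest monomial `b` of its fibre is a second one
      -- with this property, and uniqueness forces `b = a`.
      obtain ⟨b, hb, hbmin, hlt⟩ := IsFiberMin.exists_lt ha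
      have hbS : ∀ p ∈ S, ¬ m.degree p ≤ b := by
        intro p hp hle
        refine not_isFiberMin_degree ?_ ?_ (hbmin.of_le hle)
        · rcases hp with ⟨p, hp, rfl⟩ | ⟨p, hp, rfl⟩
          · exact rename_mem_toricIdeal hd₁ (hS₁.subset hp)
          · exact rename_mem_toricIdeal hd₂ (hS₂.subset hp)
        · rintro rfl
          simpa using hlc 0 hp
      have hloc : ∀ x : τ →₀ ℕ, (∀ p ∈ S, ¬ m.degree p ≤ x) →
          IsFiberMin m₁ A₁ (x.comapDomain ι₁ hg.inj₁.injOn) ∧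
          IsFiberMin m₂ A₂ (x.comapDomain ι₂ hg.inj₂.injOn) := fun x hx =>
        ⟨isFiberMin_comapDomain hm₁ hg.inj₁ hS₁ fun p hp => hx _ (Or.inl ⟨p, hp, rfl⟩),
          isFiberMin_comapDomain hm₂ hg.inj₂ hS₂ fun p hp => hx _ (Or.inr ⟨p, hp, rfl⟩)⟩
      have hba := hg.eq_of_isFiberMin hm₁ hblock (hloc b hbS).1 (hloc a hcon).1
        (hloc b hbS).2 (hloc a hcon).2 hb
      exact absurd hlt (by rw [hba]; exact lt_irrefl _)
  refine ⟨m, S, ⟨hGB, hlc, ?_⟩, hGB.span_eq_toricIdeal hlc, ?_⟩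
  · classical
    rintro _ (⟨p, hp, rfl⟩ | ⟨p, hp, rfl⟩) _ (⟨q, hq, rfl⟩ | ⟨q, hq, rfl⟩) hqp d hd
    · exact not_le_support_rename hm₁ hg.inj₁ hS₁ hp hq hqp hd
    · rw [support_rename_of_injective hg.inj₁, Finset.mem_image] at hd
      obtain ⟨d, -, rfl⟩ := hd
      exact not_degree_rename_le_mapDomain hm₂ hg.inj₂ hg.fiber₂ (hS₂.subset hq) (hne₂ q hq) d
    · rw [support_rename_of_injective hg.inj₂, Finset.mem_image] at hd
      obtain ⟨d, -, rfl⟩ := hd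
      exact not_degree_rename_le_mapDomain hm₁ hg.inj₁ hg.fiber₁ (hS₁.subset hq) (hne₁ q hq) d
    · exact not_le_support_rename hm₂ hg.inj₂ hS₂ hp hq hqp hd
  · intro T hT hspan
    refine hT.2 ?_
    rintro _ (⟨p, hp, rfl⟩ | ⟨p, hp, rfl⟩)
    · exact rename_mem_of_span_eq hg.inj₁ hd₁ hg.fiber₂ hmin₁ hS₂.subset hT.1 hspan hp
    · refine rename_mem_of_span_eq hg.inj₂ hd₂ hg.fiber₁ hmin₂ hS₁.subset ?_ hspan hp
      rw [Set.union_comm]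
      exact hT.1

/-! ### Edge vectors of graphs. -/

section Graph

variable {V V' W : Type*} {G : SimpleGraph V} {G' : SimpleGraph V'} {H : SimpleGraph W}

open Classical in
theorem edgeVector_apply (e : G.edgeSet) (x : V) :
    edgeVector G e x = if x ∈ (e : Sym2 V) then 1 else 0 := by
  simp [edgeVector, Set.indicator_apply]

theorem edgeVector_mapEdgeSet (φ : G →g H) (hφ : Function.Injective φ) (e : G.edgeSet) (x : V) :
    edgeVector H (φ.mapEdgeSet e) (φ x) = edgeVector G e x := by
  classical
  rw [edgeVector_apply, edgeVector_apply]
  refine if_congr ?_ rfl rfl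
  rw [SimpleGraph.Hom.mapEdgeSet_coe, Sym2.mem_map]
  exact ⟨fun ⟨y, hy, h⟩ => hφ h ▸ hy, fun h => ⟨x, h, rfl⟩⟩

theorem edgeVector_mapEdgeSet_of_notMem (φ : G →g H) (e : G.edgeSet) {w : W}
    (hw : w ∉ Set.range φ) : edgeVector H (φ.mapEdgeSet e) w = 0 := by
  classical
  rw [edgeVector_apply, if_neg]
  rw [SimpleGraph.Hom.mapEdgeSet_coe, Sym2.mem_map]
  rintro ⟨y, -, rfl⟩
  exact hw ⟨y, rfl⟩

theorem aDegree_mapEdgeSet (φ : G →g H) (hφ : Function.Injective φ) (a : G.edgeSet →₀ ℕ)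
    (x : V) :
    aDegree (edgeVector H) (a.mapDomain φ.mapEdgeSet) (φ x) = aDegree (edgeVector G) a x := by
  rw [aDegree_mapDomain, aDegree_apply, aDegree_apply]
  simp only [Function.comp_apply, edgeVector_mapEdgeSet φ hφ]

theorem aDegree_mapEdgeSet_of_notMem (φ : G →g H) (a : G.edgeSet →₀ ℕ) {w : W}
    (hw : w ∉ Set.range φ) :
    aDegree (edgeVector H) (a.mapDomain φ.mapEdgeSet) w = 0 := by
  rw [aDegree_mapDomain, aDegree_apply]
  simp [Function.comp_apply, edgeVector_mapEdgeSet_of_notMem φ _ hw]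

theorem aDegree_mapEdgeSet_eq_iff (φ : G →g H) (hφ : Function.Injective φ)
    (a b : G.edgeSet →₀ ℕ) :
    aDegree (edgeVector H) (a.mapDomain φ.mapEdgeSet) =
      aDegree (edgeVector H) (b.mapDomain φ.mapEdgeSet) ↔
    aDegree (edgeVector G) a = aDegree (edgeVector G) b := by
  constructor
  · intro h
    funext x
    rw [← aDegree_mapEdgeSet φ hφ, h, aDegree_mapEdgeSet φ hφ]
  · intro h
    funext w
    by_cases hw : w ∈ Set.range φ
    · obtain ⟨x, rfl⟩ := hw
      rw [aDegree_mapEdgeSet φ hφ, h, aDegree_mapEdgeSet φ hφ]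
    · rw [aDegree_mapEdgeSet_of_notMem φ a hw, aDegree_mapEdgeSet_of_notMem φ b hw]

theorem sum_mul_edgeVector [Fintype V] (g : V → ℤ) {x y : V} (h : G.Adj x y) :
    ∑ z, g z * (edgeVector G ⟨s(x, y), h⟩ z : ℤ) = g x + g y := by
  classical
  rw [← Finset.sum_pair (f := g) h.ne, ← Finset.sum_subset (Finset.subset_univ {x, y})]
  · refine Finset.sum_congr rfl fun z hz => ?_
    rw [edgeVector_apply, if_pos (by simpa using hz), Nat.cast_one, mul_one]
  · intro z _ hz
    rw [edgeVector_apply, if_neg (by simpa using hz), Nat.cast_zero, mul_zero]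

/-- Double counting: each edge contributes total vertex weight `k`. Constant weight `1` gives
homogeneity; weights `±1` by colour class give the bipartite balance with `k = 0`. -/
theorem sum_mul_aDegree [Fintype V] (g : V → ℤ) {k : ℤ} (hg : ∀ x y, G.Adj x y → g x + g y = k)
    (a : G.edgeSet →₀ ℕ) :
    ∑ z, g z * (aDegree (edgeVector G) a z : ℤ) = k * a.degree := by
  induction a using Finsupp.induction_linear with
  | zero => simp [aDegree_zero]
  | add a b ha hb =>
    simp only [aDegree_add, Pi.add_apply, Nat.cast_add, mul_add, Finset.sum_add_distrib, ha, hb,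
      map_add]
  | single e n =>
    obtain ⟨e, he⟩ := e
    induction e using Sym2.ind with
    | _ x y =>
      have h := sum_mul_edgeVector g (G := G) he
      rw [hg x y he] at h
      rw [← h, Finset.sum_mul]
      refine Finset.sum_congr rfl fun z _ => ?_
      simp only [aDegree_single, Pi.smul_apply, smul_eq_mul, Nat.cast_mul, Finsupp.degree_single]
      ring

theorem degree_eq_of_aDegree_edgeVector_eq [Finite V] {a b : G.edgeSet →₀ ℕ}
    (h : aDegree (edgeVector G) a = aDegree (edgeVector G) b) : a.degree = b.degree := by
  obtain ⟨_⟩ := nonempty_fintype V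
  have ha := sum_mul_aDegree (G := G) (fun _ => 1) (k := 2) (fun _ _ _ => rfl) a
  have hb := sum_mul_aDegree (G := G) (fun _ => 1) (k := 2) (fun _ _ _ => rfl) b
  rw [h] at ha
  omega

/-- In a bipartite graph, two degree vectors agreeing away from an edge (resp. a vertex) differ by
a multiple of the edge vector (resp. coincide). -/
theorem SimpleGraph.IsBipartite.aDegree_sub_eq [Finite V] (hG : G.IsBipartite)
    {a b : G.edgeSet →₀ ℕ} {x y : V}
    (h : ∀ z, z ≠ x → z ≠ y → aDegree (edgeVector G) a z = aDegree (edgeVector G) b z) :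
    (G.Adj x y → (aDegree (edgeVector G) a x : ℤ) - aDegree (edgeVector G) b x =
      aDegree (edgeVector G) a y - aDegree (edgeVector G) b y) ∧
    (x = y → aDegree (edgeVector G) a x = aDegree (edgeVector G) b x) := by
  classical
  obtain ⟨_⟩ := nonempty_fintype V
  obtain ⟨c⟩ := hG
  let g : V → ℤ := fun z => if c z = 0 then 1 else -1
  have hg : ∀ z w, G.Adj z w → g z + g w = 0 := by
    intro z w hzw
    have := c.valid hzw
    simp only [g]
    split_ifs <;> omega
  have hs : ∑ z, g z * ((aDegree (edgeVector G) a z : ℤ) - aDegree (edgeVector G) b z) = 0 := by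
    simp only [mul_sub, Finset.sum_sub_distrib, sum_mul_aDegree g hg, zero_mul, sub_zero]
  have hne : ∀ z, g z = 1 ∨ g z = -1 := by
    intro z
    simp only [g]
    split_ifs <;> simp
  constructor
  · intro hxy
    rw [← Finset.sum_subset (Finset.subset_univ {x, y}), Finset.sum_pair hxy.ne] at hs
    · have h1 := hg x y hxy
      rcases hne x with hx | hx
      · have hy : g y = -1 := by omega
        rw [hx, hy] at hs
        omega
      · have hy : g y = 1 := by omega
        rw [hx, hy] at hs
        omega
    · intro z _ hz
      simp only [Finset.mem_insert, Finset.mem_singleton, not_or] at hz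
      rw [h z hz.1 hz.2, sub_self, mul_zero]
  · rintro rfl
    rw [Finset.sum_eq_single x] at hs
    · rcases hne x with hx | hx <;> rw [hx] at hs <;> omega
    · intro z _ hz
      rw [h z hz hz, sub_self, mul_zero]
    · simp

theorem exists_mem_of_aDegree_edgeVector_ne_zero {a : G.edgeSet →₀ ℕ} {x : V}
    (h : aDegree (edgeVector G) a x ≠ 0) : ∃ e ∈ a.support, x ∈ (e : Sym2 V) := by
  classical
  by_contra! hcon
  refine h ?_
  rw [aDegree_apply]
  refine Finset.sum_eq_zero fun e he => ?_
  simp only [edgeVector_apply, if_neg (hcon e he), mul_zero]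

theorem aDegree_edgeVector_ne_zero {a : G.edgeSet →₀ ℕ} {x : V} {e : G.edgeSet}
    (he : e ∈ a.support) (hx : x ∈ (e : Sym2 V)) : aDegree (edgeVector G) a x ≠ 0 := by
  classical
  rw [aDegree_apply]
  intro h
  have := Finset.sum_eq_zero_iff.1 h e he
  simp only [edgeVector_apply, if_pos hx, mul_one] at this
  exact Finsupp.mem_support_iff.1 he this

/-- A power of a single edge variable is alone in its fibre. -/
theorem eq_of_aDegree_edgeVector_eq [Finite V] {s : Set G.edgeSet} (hs : s.Subsingleton)
    {a b : G.edgeSet →₀ ℕ} (ha : ∀ e ∈ a.support, e ∈ s)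
    (h : aDegree (edgeVector G) a = aDegree (edgeVector G) b) : a = b := by
  -- The endpoints of an edge of `b` have positive degree, so edges of `a` cover them; these are all
  -- the same edge, which therefore equals `e`.
  have hb : ∀ e ∈ b.support, e ∈ s := by
    intro e he
    obtain ⟨x, y, hxy⟩ : ∃ x y, (e : Sym2 V) = s(x, y) := by
      induction h : (e : Sym2 V) using Sym2.ind with
      | _ x y => exact ⟨x, y, rfl⟩
    have hadj : G.Adj x y := by
      have := e.2
      rwa [hxy] at this
    have hval : ∀ z ∈ (e : Sym2 V), ∃ e' ∈ a.support, z ∈ (e' : Sym2 V) := fun z hz =>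
      exists_mem_of_aDegree_edgeVector_ne_zero (h ▸ aDegree_edgeVector_ne_zero he hz)
    obtain ⟨e₁, he₁, hx⟩ := hval x (by simp [hxy])
    obtain ⟨e₂, he₂, hy⟩ := hval y (by simp [hxy])
    rw [← hs (ha _ he₁) (ha _ he₂)] at hy
    have : e = e₁ := Subtype.ext (hxy.trans ((Sym2.mem_and_mem_iff hadj.ne).1 ⟨hx, hy⟩).symm)
    exact this ▸ ha _ he₁
  have hdeg := degree_eq_of_aDegree_edgeVector_eq h
  ext e
  by_cases he : e ∈ s
  · rw [← Finsupp.degree_eq_apply fun j hj => hs (ha j hj) he, hdeg,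
      Finsupp.degree_eq_apply fun j hj => hs (hb j hj) he]
  · rw [Finsupp.notMem_support_iff.1 (mt (ha e) he), Finsupp.notMem_support_iff.1 (mt (hb e) he)]

theorem edge_eq_of_mapEdgeSet_mem_range {φ : G →g H} {ψ : G' →g H} {x y : V}
    (h : ∀ z, φ z ∈ Set.range ψ → z = x ∨ z = y) {e : G.edgeSet}
    (he : φ.mapEdgeSet e ∈ Set.range ψ.mapEdgeSet) : (e : Sym2 V) = s(x, y) := by
  obtain ⟨e', he'⟩ := he
  have hmem : ∀ z ∈ (e : Sym2 V), z = x ∨ z = y := by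
    intro z hz
    refine h z ?_
    have : φ z ∈ ((ψ.mapEdgeSet e' : H.edgeSet) : Sym2 W) := by
      rw [he', SimpleGraph.Hom.mapEdgeSet_coe]
      exact Sym2.mem_map.2 ⟨z, hz, rfl⟩
    rw [SimpleGraph.Hom.mapEdgeSet_coe, Sym2.mem_map] at this
    obtain ⟨w, -, hw⟩ := this
    exact ⟨w, hw⟩
  obtain ⟨e, he⟩ := e
  induction e using Sym2.ind with
  | _ p q =>
    have hpq : p ≠ q := G.ne_of_adj he
    rcases hmem p (by simp) with rfl | rfl <;> rcases hmem q (by simp) with rfl | rfl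
    · exact absurd rfl hpq
    · rfl
    · exact Sym2.eq_swap
    · exact absurd rfl hpq

end Graph

/-! ### Clique sums as gluings. -/

/-- Both kinds of sum are treated at once, the 1-clique sum being the degenerate case `u₁ = v₁`, `u₂
= v₂`, where no edge is shared. -/
theorem isToricGluing_edgeVector {V₁ V₂ W : Type*} [Finite V₁] [Finite V₂]
    {G₁ : SimpleGraph V₁} {G₂ : SimpleGraph V₂} {H : SimpleGraph W}
    (hbip : G₁.IsBipartite ∨ G₂.IsBipartite) (φ₁ : G₁ →g H) (φ₂ : G₂ →g H)
    (hφ₁ : Function.Injective φ₁) (hφ₂ : Function.Injective φ₂) {u₁ v₁ : V₁} {u₂ v₂ : V₂}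
    (hφ : ∀ a b, φ₁ a = φ₂ b ↔ (a = u₁ ∧ b = u₂) ∨ (a = v₁ ∧ b = v₂))
    (hH : ∀ x y, H.Adj x y → (∃ a b, G₁.Adj a b ∧ φ₁ a = x ∧ φ₁ b = y) ∨
      ∃ a b, G₂.Adj a b ∧ φ₂ a = x ∧ φ₂ b = y)
    (hcase : (G₁.Adj u₁ v₁ ∧ G₂.Adj u₂ v₂) ∨ (u₁ = v₁ ∧ u₂ = v₂)) :
    IsToricGluing (edgeVector G₁) (edgeVector G₂) (edgeVector H) φ₁.mapEdgeSet
      φ₂.mapEdgeSet := by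
  classical
  have hu : φ₁ u₁ = φ₂ u₂ := (hφ _ _).2 (Or.inl ⟨rfl, rfl⟩)
  have hv : φ₁ v₁ = φ₂ v₂ := (hφ _ _).2 (Or.inr ⟨rfl, rfl⟩)
  have hc₁ : ∀ z, φ₁ z ∈ Set.range φ₂ → z = u₁ ∨ z = v₁ := by
    rintro z ⟨w, hw⟩
    exact ((hφ _ _).1 hw.symm).imp And.left And.left
  have hc₂ : ∀ z, φ₂ z ∈ Set.range φ₁ → z = u₂ ∨ z = v₂ := by
    rintro z ⟨w, hw⟩
    exact ((hφ _ _).1 hw).imp And.right And.right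
  have hs₁ : {e | φ₁.mapEdgeSet e ∈ Set.range φ₂.mapEdgeSet}.Subsingleton := fun e he f hf =>
    Subtype.ext ((edge_eq_of_mapEdgeSet_mem_range hc₁ he).trans
      (edge_eq_of_mapEdgeSet_mem_range hc₁ hf).symm)
  have hs₂ : {e | φ₂.mapEdgeSet e ∈ Set.range φ₁.mapEdgeSet}.Subsingleton := fun e he f hf =>
    Subtype.ext ((edge_eq_of_mapEdgeSet_mem_range hc₂ he).trans
      (edge_eq_of_mapEdgeSet_mem_range hc₂ hf).symm)
  refine ⟨SimpleGraph.Hom.mapEdgeSet.injective φ₁ hφ₁,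
    SimpleGraph.Hom.mapEdgeSet.injective φ₂ hφ₂, ?_, fun i j hi hj => hs₁ hi hj,
    aDegree_mapEdgeSet_eq_iff φ₁ hφ₁, aDegree_mapEdgeSet_eq_iff φ₂ hφ₂,
    fun a b => degree_eq_of_aDegree_edgeVector_eq,
    fun a b ha => eq_of_aDegree_edgeVector_eq hs₁ ha,
    fun a b ha => eq_of_aDegree_edgeVector_eq hs₂ ha, ?_⟩
  · rintro ⟨e, he⟩
    induction e using Sym2.ind with
    | _ x y =>
      rcases hH x y he with ⟨a, b, hab, rfl, rfl⟩ | ⟨a, b, hab, rfl, rfl⟩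
      · exact Or.inl ⟨⟨s(a, b), hab⟩, rfl⟩
      · exact Or.inr ⟨⟨s(a, b), hab⟩, rfl⟩
  · intro a₁ b₁ a₂ b₂ hab
    rw [aDegree_add, aDegree_add] at hab
    have h₁ : ∀ z, z ≠ u₁ → z ≠ v₁ →
        aDegree (edgeVector G₁) a₁ z = aDegree (edgeVector G₁) b₁ z := by
      intro z hzu hzv
      have hz : φ₁ z ∉ Set.range φ₂ := fun h => (hc₁ z h).elim hzu hzv
      have := congrFun hab (φ₁ z)
      rwa [Pi.add_apply, Pi.add_apply, aDegree_mapEdgeSet_of_notMem φ₂ _ hz,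
        aDegree_mapEdgeSet_of_notMem φ₂ _ hz, aDegree_mapEdgeSet φ₁ hφ₁,
        aDegree_mapEdgeSet φ₁ hφ₁] at this
    have h₂ : ∀ z, z ≠ u₂ → z ≠ v₂ →
        aDegree (edgeVector G₂) a₂ z = aDegree (edgeVector G₂) b₂ z := by
      intro z hzu hzv
      have hz : φ₂ z ∉ Set.range φ₁ := fun h => (hc₂ z h).elim hzu hzv
      have := congrFun hab (φ₂ z)
      rwa [Pi.add_apply, Pi.add_apply, aDegree_mapEdgeSet_of_notMem φ₁ _ hz,
        aDegree_mapEdgeSet_of_notMem φ₁ _ hz, aDegree_mapEdgeSet φ₂ hφ₂,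
        aDegree_mapEdgeSet φ₂ hφ₂, zero_add, zero_add] at this
    have hshared : ∀ {x₁ : V₁} {x₂ : V₂}, φ₁ x₁ = φ₂ x₂ →
        aDegree (edgeVector G₁) a₁ x₁ + aDegree (edgeVector G₂) a₂ x₂ =
          aDegree (edgeVector G₁) b₁ x₁ + aDegree (edgeVector G₂) b₂ x₂ := by
      intro x₁ x₂ hx
      have := congrFun hab (φ₁ x₁)
      rwa [Pi.add_apply, Pi.add_apply, aDegree_mapEdgeSet φ₁ hφ₁, aDegree_mapEdgeSet φ₁ hφ₁, hx,
        aDegree_mapEdgeSet φ₂ hφ₂, aDegree_mapEdgeSet φ₂ hφ₂] at this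
    have hsu := hshared hu
    have hsv := hshared hv
    rcases hcase with ⟨hadj₁, hadj₂⟩ | ⟨rfl, rfl⟩
    -- At a shared vertex the discrepancies of the two sides are opposite, so it does not matter
    -- which side is bipartite.
    · have hd : (aDegree (edgeVector G₁) a₁ u₁ : ℤ) - aDegree (edgeVector G₁) b₁ u₁ =
          aDegree (edgeVector G₁) a₁ v₁ - aDegree (edgeVector G₁) b₁ v₁ := by
        rcases hbip with hG | hG
        · exact (hG.aDegree_sub_eq h₁).1 hadj₁
        · have := (hG.aDegree_sub_eq h₂).1 hadj₂
          omega
      let e : G₁.edgeSet := ⟨s(u₁, v₁), hadj₁⟩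
      have he : φ₁.mapEdgeSet e ∈ Set.range φ₂.mapEdgeSet := by
        refine ⟨⟨s(u₂, v₂), hadj₂⟩, Subtype.ext ?_⟩
        simp [e, hu, hv]
      have hsupp : ∀ (n : ℕ), ∀ i ∈ (Finsupp.single e n).support,
          φ₁.mapEdgeSet i ∈ Set.range φ₂.mapEdgeSet := by
        intro n i hi
        rw [Finset.mem_singleton.1 (Finsupp.support_single_subset hi)]
        exact he
      -- Equal deficits `n` at both ends of the shared edge `e` are filled by `n` copies of `e`.
      have key : ∀ p q : G₁.edgeSet →₀ ℕ,
          (∀ z, z ≠ u₁ → z ≠ v₁ → aDegree (edgeVector G₁) p z = aDegree (edgeVector G₁) q z) →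
          ∀ n : ℕ, aDegree (edgeVector G₁) p u₁ + n = aDegree (edgeVector G₁) q u₁ →
          aDegree (edgeVector G₁) p v₁ + n = aDegree (edgeVector G₁) q v₁ →
          aDegree (edgeVector G₁) (p + Finsupp.single e n) = aDegree (edgeVector G₁) q := by
        intro p q hpq n hpu hpv
        funext z
        rw [aDegree_add, aDegree_single, Pi.add_apply, Pi.smul_apply, edgeVector_apply, smul_eq_mul]
        by_cases hzu : z = u₁
        · subst hzu
          rw [if_pos (by simp [e]), mul_one, hpu]
        by_cases hzv : z = v₁
        · subst hzv
          rw [if_pos (by simp [e]), mul_one, hpv]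
        rw [if_neg (by simp [e, hzu, hzv]), mul_zero, add_zero, hpq z hzu hzv]
      rcases le_total (aDegree (edgeVector G₁) a₁ u₁) (aDegree (edgeVector G₁) b₁ u₁) with h | h
      · obtain ⟨n, hn⟩ := Nat.exists_eq_add_of_le h
        exact ⟨_, hsupp n, Or.inl (key _ _ h₁ n hn.symm (by omega))⟩
      · obtain ⟨n, hn⟩ := Nat.exists_eq_add_of_le h
        exact ⟨_, hsupp n, Or.inr
          (key _ _ (fun z hz hz' => (h₁ z hz hz').symm) n hn.symm (by omega)).symm⟩
    · refine ⟨0, by simp, Or.inl ?_⟩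
      have hd : aDegree (edgeVector G₁) a₁ u₁ = aDegree (edgeVector G₁) b₁ u₁ := by
        rcases hbip with hG | hG
        · exact (hG.aDegree_sub_eq h₁).2 rfl
        · have := (hG.aDegree_sub_eq h₂).2 rfl
          omega
      rw [add_zero]
      funext z
      by_cases hz : z = u₁
      · rw [hz, hd]
      · exact h₁ z hz hz

theorem IsGluing.isMG {K : Type*} [Field K] {V₁ V₂ W : Type*} [Finite V₁] [Finite V₂]
    {G₁ : SimpleGraph V₁} {G₂ : SimpleGraph V₂} {H : SimpleGraph W}
    (h₁ : G₁.IsUMG K) (h₂ : G₂.IsMG K) (hbip : G₁.IsBipartite ∨ G₂.IsBipartite)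
    {u₁ v₁ : V₁} {u₂ v₂ : V₂}
    (hcase : (G₁.Adj u₁ v₁ ∧ G₂.Adj u₂ v₂) ∨ (u₁ = v₁ ∧ u₂ = v₂))
    (hgl : IsGluing (fun a b => (a = u₁ ∧ b = u₂) ∨ (a = v₁ ∧ b = v₂)) G₁ G₂ H) : H.IsMG K := by
  obtain ⟨f₁, f₂, hrange, hr, rfl⟩ := hgl
  have : Finite W :=
    Set.finite_univ_iff.1 (hrange ▸ (Set.finite_range f₁).union (Set.finite_range f₂))
  let φ₁ : G₁ →g G₁.map f₁ ⊔ G₂.map f₂ :=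
    ⟨f₁, fun h => Or.inl ((SimpleGraph.map_adj _ _ _ _).2 ⟨_, _, h, rfl, rfl⟩)⟩
  let φ₂ : G₂ →g G₁.map f₁ ⊔ G₂.map f₂ :=
    ⟨f₂, fun h => Or.inr ((SimpleGraph.map_adj _ _ _ _).2 ⟨_, _, h, rfl, rfl⟩)⟩
  refine (isToricGluing_edgeVector hbip φ₁ φ₂ f₁.injective f₂.injective hr ?_ hcase).isMGIdeal
    h₁ h₂
  rintro x y (h | h)
  · exact Or.inl ((SimpleGraph.map_adj _ _ _ _).1 h)
  · exact Or.inr ((SimpleGraph.map_adj _ _ _ _).1 h)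

theorem proposition4p6 {K : Type*} [Field K] {V₁ V₂ W : Type*} [Finite V₁] [Finite V₂]
    (G₁ : SimpleGraph V₁) (G₂ : SimpleGraph V₂) (H : SimpleGraph W)
    (h₁ : G₁.IsUMG K) (h₂ : G₂.IsMG K) (hbip : G₁.IsBipartite ∨ G₂.IsBipartite) :
    (IsOneCliqueSum G₁ G₂ H → H.IsMG K) ∧ (IsTwoCliqueSum G₁ G₂ H → H.IsMG K) := by
  constructor
  · rintro ⟨v₁, v₂, hgl⟩
    refine IsGluing.isMG h₁ h₂ hbip (Or.inr ⟨rfl, rfl⟩) (u₁ := v₁) (u₂ := v₂) ?_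
    simpa only [or_self] using hgl
  · rintro ⟨u₁, v₁, u₂, v₂, hadj₁, hadj₂, hgl⟩
    exact IsGluing.isMG h₁ h₂ hbip (Or.inl ⟨hadj₁, hadj₂⟩) hgl
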